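/- Let $n\ge 1$, $\lambda_p,\lambda_d,r_d>0$, and let $\Phi=\bigcup_i(\mathbf x_i+\Phi_i)$ be the Matérn cluster process in $\mathbb R^n$ with these parameters: the parent points $\{\mathbf x_i: i\in\mathbb N\}$ form a homogeneous Poisson point process on $\mathbb R^n$ of density $\lambda_p$; each daughter process $\Phi_i$ is a Poisson point process of density $\lambda_d$ in the ball $\mathcal B(\mathrm o,r_d)$ of radius $r_d$ centred at the origin; and the daughter processes are independent of each other and of the parent points. Let $R_C$ be the contact distance, i.e. the distance from a fixed arbitrary location $\mathbf y\in\mathbb R^n$ (for instance the origin) to the closest point of $\Phi$; it is a random variable, with distribution function $F_{R_C}(r)=\mathbb P(R_C\le r)$. Let $v_n$ be the volume of the unit ball of $\mathbb R^n$ and $\beta(r)=\min\{r,r_d\}$. Then for every $r\ge 0$ $$1-\exp\left(-v_n\lambda_p\,|r-r_d|^n\left(1-e^{-\lambda_d v_n\beta^n(r)}\right)\right)\;\le\;F_{R_C}(r)\;\le\;1-\exp\left(-v_n\lambda_p\,(r+r_d)^n\left(1-e^{-v_n\lambda_d\beta^n(r)}\right)\right).$$ -/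

import Mathlib

open MeasureTheory ProbabilityTheory
open scoped NNReal ENNReal

/-- A point configuration: a locally finite set of points. -/
structure PointConfig (E : Type*) [TopologicalSpace E] where
  /-- the set of points -/
  points : Set E
  /-- every compact set contains only finitely many of the points -/
  locallyFinite : ∀ K : Set E, IsCompact K → (points ∩ K).Finite

namespace PointConfig

/-- The number of points of the configuration `s` in the set `B`. -/
noncomputable def count {E : Type*} [TopologicalSpace E] (B : Set E) (s : PointConfig E) : ℕ∞ :=
  (s.points ∩ B).encard

/-- The usual σ-algebra on configurations: the smallest one for which all the numbers of points
in measurable sets are measurable. -/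
noncomputable instance instMeasurableSpace {E : Type*} [TopologicalSpace E] [MeasurableSpace E] :
    MeasurableSpace (PointConfig E) :=
  ⨆ (B : Set E) (_ : MeasurableSet B), MeasurableSpace.comap (count B) inferInstance

end PointConfig

/-- `N` is a (simple) Poisson point process with (diffuse) intensity measure `μ`: it is a random
point configuration, the number of points in a measurable set `B` of finite intensity is Poisson
distributed with mean `μ B`, and the numbers of points in finitely many pairwise disjoint
measurable sets are independent. -/
structure IsPoissonProcess {Ω E : Type*} [MeasurableSpace Ω] [TopologicalSpace E]
    [MeasurableSpace E] (N : Ω → PointConfig E) (μ : Measure E) (P : Measure Ω) : Prop where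
  measurable : Measurable N
  hasLaw_count : ∀ B : Set E, MeasurableSet B → μ B < ∞ →
    HasLaw (fun ω => (N ω).count B) ((poissonMeasure (μ B).toNNReal).map ((↑) : ℕ → ℕ∞)) P
  iIndepFun_count : ∀ (k : ℕ) (B : Fin k → Set E), (∀ i, MeasurableSet (B i)) →
    (Pairwise fun i j => Disjoint (B i) (B j)) →
    iIndepFun (fun i ω => (N ω).count (B i)) P

/-- The cluster process with parent points `X i` and daughter processes `D i`: the union of the
daughter processes shifted to their parent points. -/
def clusterProcess {Ω E : Type*} [TopologicalSpace E] [Add E]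
    (X : ℕ → Ω → E) (D : ℕ → Ω → PointConfig E) (ω : Ω) : Set E :=
  {z | ∃ i, ∃ d ∈ (D i ω).points, z = X i ω + d}

/-- The data defining an `n`-dimensional Matérn cluster process: the parent process `parent` is a
Poisson process of density `lp`, with points enumerated as `X 0, X 1, …`; each daughter process
`D i` is a Poisson process of density `ld` in the ball of radius `rd` centred at the origin; the
daughter processes are independent of each other and of the parent points. -/
structure IsMaternClusterProcess {Ω : Type*} [MeasurableSpace Ω] {n : ℕ}
    (parent : Ω → PointConfig (EuclideanSpace ℝ (Fin n)))
    (X : ℕ → Ω → EuclideanSpace ℝ (Fin n))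
    (D : ℕ → Ω → PointConfig (EuclideanSpace ℝ (Fin n)))
    (lp ld rd : ℝ) (P : Measure Ω) : Prop where
  isPoisson_parent : IsPoissonProcess parent (ENNReal.ofReal lp • volume) P
  measurable_X : ∀ i, Measurable (X i)
  injective_X : ∀ ω, Function.Injective fun i => X i ω
  range_X : ∀ ω, (Set.range fun i => X i ω) = (parent ω).points
  isPoisson_daughter : ∀ i, IsPoissonProcess (D i)
    (ENNReal.ofReal ld • volume.restrict (Metric.closedBall 0 rd)) P
  iIndepFun_daughter : iIndepFun D P
  indepFun_parent_daughter : IndepFun (fun ω i => X i ω) (fun ω i => D i ω) P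

/-- The contact distance of the random set of points `Φ` from the location `y`: the distance
from `y` to the closest point of `Φ` (infinite if there are no points). -/
noncomputable def contactDistance {Ω E : Type*} [PseudoEMetricSpace E]
    (Φ : Ω → Set E) (y : E) (ω : Ω) : ℝ≥0∞ :=
  ⨅ z ∈ Φ ω, edist y z

/-- The cumulative distribution function of the contact distance of `Φ` from `y`. -/
noncomputable def contactCDF {Ω E : Type*} [MeasurableSpace Ω] [PseudoEMetricSpace E]
    (P : Measure Ω) (Φ : Ω → Set E) (y : E) (r : ℝ) : ℝ :=
  P.real {ω | contactDistance Φ y ω ≤ ENNReal.ofReal r}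

/-- The volume of the unit ball of `n`-dimensional Euclidean space. -/
noncomputable def unitBallVolume (n : ℕ) : ℝ :=
  volume.real (Metric.ball (0 : EuclideanSpace ℝ (Fin n)) 1)

/-! Fix the parents `x i`. The daughters leave the open ball of radius `s` about `y` empty with
probability `∏ exp (-ld * V i)`, where `V i` is the volume of `ball (y - x i) s ∩ closedBall 0 rd`.
Always `V i ≤ v_n β ^ n`, with equality if `‖y - x i‖ < |s - rd|`, and `V i = 0` if `‖y - x i‖ ≥ s +
rd`. With `q = exp (-ld * v_n * β ^ n)`, the conditional probability thus lies between `q ^ N (s +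
rd)` and `q ^ N |s - rd|`, where `N ρ` counts the parents within `ρ` of `y`. Averaging over the
parents with the Poisson generating function gives the bounds of `le_measure_le_contactDistance` and
`measure_le_contactDistance_le`. -/

/-! ### Poisson counts -/

/-- Void probabilities of a Poisson process. -/
theorem IsPoissonProcess.measure_count_eq_zero {Ω E : Type*} [MeasurableSpace Ω]
    [TopologicalSpace E] [MeasurableSpace E] {N : Ω → PointConfig E} {μ : Measure E}
    {P : Measure Ω} (hN : IsPoissonProcess N μ P) {B : Set E} (hB : MeasurableSet B)
    (hfin : μ B < ∞) :
    P {ω | (N ω).count B = 0} = ENNReal.ofReal (Real.exp (-μ.real B)) := by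
  have h := (hN.hasLaw_count B hB hfin).measure_eq (p := fun k => k = 0)
    (MeasurableSet.singleton (0 : ℕ∞))
  rw [h, Measure.map_apply .of_discrete .of_discrete]
  have : ((↑) : ℕ → ℕ∞) ⁻¹' {k | k = 0} = {0} := by ext; simp
  rw [this, poissonMeasure_singleton]
  simp [measureReal_def, ENNReal.coe_toNNReal_eq_toReal]

/-- The probability generating function of the number of points of a Poisson process. -/
theorem IsPoissonProcess.lintegral_pow_count {Ω E : Type*} [MeasurableSpace Ω]
    [TopologicalSpace E] [MeasurableSpace E] {N : Ω → PointConfig E} {μ : Measure E}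
    {P : Measure Ω} (hN : IsPoissonProcess N μ P) {B : Set E} (hB : MeasurableSet B)
    (hfin : μ B < ∞) {q : ℝ} (hq : 0 ≤ q) :
    ∫⁻ ω, ENNReal.ofReal q ^ ((N ω).count B).toNat ∂P
      = ENNReal.ofReal (Real.exp (-(μ.real B * (1 - q)))) := by
  have h := hN.hasLaw_count B hB hfin
  have h1 : ∫⁻ ω, ENNReal.ofReal q ^ ((N ω).count B).toNat ∂P
      = ∫⁻ k : ℕ∞, ENNReal.ofReal q ^ k.toNat ∂(P.map fun ω => (N ω).count B) :=
    (lintegral_map' (Measurable.of_discrete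
      (f := fun k : ℕ∞ => ENNReal.ofReal q ^ k.toNat)).aemeasurable h.aemeasurable).symm
  -- `toNat` sends `⊤` to `0`, which is harmless: the law of the count is carried by `ℕ`.
  rw [h1, h.map_eq, lintegral_map .of_discrete .of_discrete, lintegral_countable']
  simp only [poissonMeasure_singleton, ENat.toNat_natCast]
  set m : ℝ≥0 := (μ B).toNNReal
  have hm : (m : ℝ) = μ.real B := rfl
  rw [← hm]
  have hs : HasSum (fun k : ℕ => q ^ k * (Real.exp (-m) * (m : ℝ) ^ k / k.factorial))
      (Real.exp (-(m * (1 - q)))) := by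
    have := (NormedSpace.expSeries_div_hasSum_exp (m * q : ℝ)).mul_left (Real.exp (-m))
    rw [← Real.exp_eq_exp_ℝ, ← Real.exp_add] at this
    convert! this using 2 with k
    · rw [mul_pow]; ring
    · ring
  rw [← hs.tsum_eq, ENNReal.ofReal_tsum_of_nonneg (fun k => by positivity) hs.summable]
  refine tsum_congr fun k => ?_
  rw [ENNReal.ofReal_mul (by positivity), ENNReal.ofReal_pow hq]

/-! ### Distance to a configuration -/

namespace PointConfig

theorem measurable_count {E : Type*} [TopologicalSpace E] [MeasurableSpace E] {B : Set E}
    (hB : MeasurableSet B) : Measurable (count B) := by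
  refine Measurable.of_comap_le ?_
  exact le_iSup₂_of_le (f := fun (B : Set E) (_ : MeasurableSet B) =>
    MeasurableSpace.comap (count B) inferInstance) B hB le_rfl

theorem le_infEDist_iff_count_eq_zero {E : Type*} [PseudoEMetricSpace E] (s : PointConfig E)
    (x : E) (a : ℝ≥0∞) : a ≤ Metric.infEDist x s.points ↔ s.count (Metric.eball x a) = 0 := by
  rw [Metric.le_infEDist, count, Set.encard_eq_zero, Set.eq_empty_iff_forall_notMem]
  simp [edist_comm]

theorem measurable_infEDist {E : Type*} [PseudoEMetricSpace E] [MeasurableSpace E]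
    [OpensMeasurableSpace E] (x : E) :
    Measurable fun s : PointConfig E => Metric.infEDist x s.points := by
  refine measurable_of_Ici fun a => ?_
  have : (fun s : PointConfig E => Metric.infEDist x s.points) ⁻¹' Set.Ici a
      = count (Metric.eball x a) ⁻¹' {0} := by
    ext s
    exact s.le_infEDist_iff_count_eq_zero x a
  rw [this]
  exact measurable_count Metric.isOpen_eball.measurableSet (MeasurableSet.singleton _)

/-- Unlike a count, the distance is continuous in the location, so it is jointly measurable; this
lets a random parent be substituted for the location. -/
theorem measurable_uncurry_infEDist {E : Type*} [MetricSpace E] [SecondCountableTopology E]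
    [MeasurableSpace E] [OpensMeasurableSpace E] :
    Measurable fun p : E × PointConfig E => Metric.infEDist p.1 p.2.points :=
  measurable_uncurry_of_continuous_of_measurable
    (u := fun x (s : PointConfig E) => Metric.infEDist x s.points)
    (fun _ => Metric.continuous_infEDist) measurable_infEDist

end PointConfig

theorem contactDistance_clusterProcess {Ω E : Type*} [SeminormedAddCommGroup E]
    (X : ℕ → Ω → E) (D : ℕ → Ω → PointConfig E) (y : E) (ω : Ω) :
    contactDistance (clusterProcess X D) y ω
      = ⨅ i, Metric.infEDist (y - X i ω) (D i ω).points := by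
  have h : ∀ x d : E, edist y (x + d) = edist (y - x) d := fun x d => by
    rw [edist_dist, edist_dist, dist_eq_norm, dist_eq_norm, sub_add_eq_sub_sub]
  refine eq_of_forall_le_iff fun a => ?_
  simp only [contactDistance, clusterProcess, Set.mem_ofPred_eq, le_iInf_iff, Metric.le_infEDist]
  constructor
  · intro H i d hd
    exact h _ _ ▸ H _ ⟨i, d, hd, rfl⟩
  · rintro H _ ⟨i, d, hd, rfl⟩
    exact h _ _ ▸ H i d hd

/-! ### Volumes of intersections of two balls -/

section Intensity

variable {n : ℕ}

theorem volume_ball_eq (hn : 1 ≤ n) (x : EuclideanSpace ℝ (Fin n)) {s : ℝ} (hs : 0 ≤ s) :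
    volume (Metric.ball x s) = ENNReal.ofReal (unitBallVolume n * s ^ n) := by
  -- For `n = 0`, `s = 0` the formula fails: the open ball is empty but `0 ^ 0 = 1`.
  have : Nonempty (Fin n) := ⟨⟨0, hn⟩⟩
  rw [Measure.addHaar_ball _ _ hs, mul_comm (unitBallVolume n), ENNReal.ofReal_mul (by positivity),
    finrank_euclideanSpace_fin, unitBallVolume, ofReal_measureReal]

theorem unitBallVolume_nonneg (n : ℕ) : 0 ≤ unitBallVolume n := measureReal_nonneg

theorem parentIntensity_ball (hn : 1 ≤ n) {lp : ℝ} (hlp : 0 ≤ lp)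
    (x : EuclideanSpace ℝ (Fin n)) {s : ℝ} (hs : 0 ≤ s) :
    (ENNReal.ofReal lp • (volume : Measure (EuclideanSpace ℝ (Fin n)))) (Metric.ball x s)
      = ENNReal.ofReal (lp * (unitBallVolume n * s ^ n)) := by
  rw [Measure.smul_apply, volume_ball_eq hn x hs, smul_eq_mul, ENNReal.ofReal_mul hlp]

/-- The intensity measure of a daughter process of a Matérn cluster process. -/
noncomputable abbrev daughterIntensity (n : ℕ) (ld rd : ℝ) :
    Measure (EuclideanSpace ℝ (Fin n)) :=
  ENNReal.ofReal ld • volume.restrict (Metric.closedBall 0 rd)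

theorem daughterIntensity_ball (ld rd : ℝ) (x : EuclideanSpace ℝ (Fin n)) (s : ℝ) :
    daughterIntensity n ld rd (Metric.ball x s)
      = ENNReal.ofReal ld * volume (Metric.ball x s ∩ Metric.closedBall 0 rd) := by
  rw [Measure.smul_apply, Measure.restrict_apply measurableSet_ball, smul_eq_mul]

theorem volume_closedBall_eq (hn : 1 ≤ n) (x : EuclideanSpace ℝ (Fin n)) {s : ℝ} (hs : 0 ≤ s) :
    volume (Metric.closedBall x s) = ENNReal.ofReal (unitBallVolume n * s ^ n) := by
  have : Nonempty (Fin n) := ⟨⟨0, hn⟩⟩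
  rw [Measure.addHaar_closedBall_eq_addHaar_ball, volume_ball_eq hn x hs]

theorem daughterIntensity_ball_le (hn : 1 ≤ n) {ld rd s : ℝ} (hld : 0 ≤ ld) (hrd : 0 ≤ rd)
    (hs : 0 ≤ s) (x : EuclideanSpace ℝ (Fin n)) :
    daughterIntensity n ld rd (Metric.ball x s)
      ≤ ENNReal.ofReal (ld * (unitBallVolume n * min s rd ^ n)) := by
  rw [daughterIntensity_ball, ENNReal.ofReal_mul hld]
  gcongr
  rcases le_total s rd with h | h
  · rw [min_eq_left h, ← volume_ball_eq hn x hs]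
    exact measure_mono Set.inter_subset_left
  · rw [min_eq_right h, ← volume_closedBall_eq hn 0 hrd]
    exact measure_mono Set.inter_subset_right

theorem daughterIntensity_ball_eq_zero {ld rd s : ℝ} {x : EuclideanSpace ℝ (Fin n)}
    (hx : s + rd ≤ ‖x‖) : daughterIntensity n ld rd (Metric.ball x s) = 0 := by
  rw [daughterIntensity_ball]
  have : Metric.ball x s ∩ Metric.closedBall 0 rd = ∅ :=
    (Metric.ball_disjoint_closedBall (by simpa using hx)).inter_eq
  simp [this]

/-- With centres closer than the difference of the radii, the smaller ball lies inside the larger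
one. -/
theorem daughterIntensity_ball_eq (hn : 1 ≤ n) {ld rd s : ℝ} (hld : 0 ≤ ld) (hrd : 0 ≤ rd)
    (hs : 0 ≤ s) {x : EuclideanSpace ℝ (Fin n)} (hx : ‖x‖ < |s - rd|) :
    daughterIntensity n ld rd (Metric.ball x s)
      = ENNReal.ofReal (ld * (unitBallVolume n * min s rd ^ n)) := by
  rw [daughterIntensity_ball, ENNReal.ofReal_mul hld]
  congr 1
  rcases le_total s rd with h | h
  · rw [abs_of_nonpos (by linarith)] at hx
    rw [min_eq_left h, ← volume_ball_eq hn x hs, Set.inter_eq_left.2]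
    exact Metric.ball_subset_closedBall.trans
      (Metric.closedBall_subset_closedBall' (by rw [dist_zero_right]; linarith))
  · rw [abs_of_nonneg (by linarith)] at hx
    rw [min_eq_right h, ← volume_closedBall_eq hn 0 hrd, Set.inter_eq_right.2]
    exact Metric.closedBall_subset_ball' (by rw [dist_zero_left]; linarith)

end Intensity

/-! ### Void probabilities of the cluster process -/

namespace IsMaternClusterProcess

variable {Ω : Type*} [MeasurableSpace Ω] {P : Measure Ω} {n : ℕ} {lp ld rd : ℝ}
  {parent : Ω → PointConfig (EuclideanSpace ℝ (Fin n))}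
  {X : ℕ → Ω → EuclideanSpace ℝ (Fin n)}
  {D : ℕ → Ω → PointConfig (EuclideanSpace ℝ (Fin n))}

theorem measurable_contactDistance (hΦ : IsMaternClusterProcess parent X D lp ld rd P)
    (y : EuclideanSpace ℝ (Fin n)) : Measurable (contactDistance (clusterProcess X D) y) := by
  rw [funext (contactDistance_clusterProcess X D y)]
  exact Measurable.iInf fun i => PointConfig.measurable_uncurry_infEDist.comp
    (((hΦ.measurable_X i).const_sub y).prodMk (hΦ.isPoisson_daughter i).measurable)

/-- Integrating out the daughter processes with the parent points kept fixed. -/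
theorem measure_le_contactDistance [IsProbabilityMeasure P]
    (hΦ : IsMaternClusterProcess parent X D lp ld rd P) (y : EuclideanSpace ℝ (Fin n))
    (a : ℝ≥0∞) :
    P {ω | a ≤ contactDistance (clusterProcess X D) y ω}
      = ∫⁻ ω, P {ω' | ∀ i, a ≤ Metric.infEDist (y - X i ω) (D i ω').points} ∂P := by
  have hX : Measurable fun ω i => X i ω := measurable_pi_lambda _ hΦ.measurable_X
  have hD : Measurable fun ω i => D i ω :=
    measurable_pi_lambda _ fun i => (hΦ.isPoisson_daughter i).measurable
  let S : Set ((ℕ → EuclideanSpace ℝ (Fin n)) × (ℕ → PointConfig (EuclideanSpace ℝ (Fin n)))) :=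
    {p | ∀ i, a ≤ Metric.infEDist (y - p.1 i) (p.2 i).points}
  have hS : MeasurableSet S := by
    have hf (i : ℕ) : Measurable fun p : (ℕ → EuclideanSpace ℝ (Fin n)) ×
        (ℕ → PointConfig (EuclideanSpace ℝ (Fin n))) => (y - p.1 i, p.2 i) :=
      (Measurable.const_sub (by fun_prop) y).prodMk (by fun_prop)
    have hg (i : ℕ) := PointConfig.measurable_uncurry_infEDist.comp (hf i)
    have hS : S = ⋂ i, {p | a ≤ Metric.infEDist (y - p.1 i) (p.2 i).points} := by
      ext p
      simp [S]
    rw [hS]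
    exact MeasurableSet.iInter fun i => measurableSet_le measurable_const (hg i)
  have h1 : {ω | a ≤ contactDistance (clusterProcess X D) y ω}
      = (fun ω => ((fun i => X i ω), fun i => D i ω)) ⁻¹' S := by
    ext ω
    simp [contactDistance_clusterProcess, S]
  -- Independence makes the joint law of parents and daughters a product, so Tonelli applies.
  rw [h1, ← Measure.map_apply (hX.prodMk hD) hS,
    hΦ.indepFun_parent_daughter.map_prod_eq_prod_map_map hX.aemeasurable hD.aemeasurable,
    Measure.prod_apply hS, lintegral_map (measurable_measure_prodMk_left hS) hX]
  refine lintegral_congr fun ω => ?_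
  rw [Measure.map_apply hD (measurable_prodMk_left hS)]
  rfl

theorem measure_daughter_void (hΦ : IsMaternClusterProcess parent X D lp ld rd P)
    (hn : 1 ≤ n) (hld : 0 ≤ ld) (hrd : 0 ≤ rd) {s : ℝ} (hs : 0 ≤ s) (i : ℕ)
    (x : EuclideanSpace ℝ (Fin n)) :
    P {ω | ENNReal.ofReal s ≤ Metric.infEDist x (D i ω).points}
      = ENNReal.ofReal (Real.exp (-(daughterIntensity n ld rd).real (Metric.ball x s))) := by
  simp_rw [PointConfig.le_infEDist_iff_count_eq_zero, Metric.eball_ofReal]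
  exact (hΦ.isPoisson_daughter i).measure_count_eq_zero measurableSet_ball
    ((daughterIntensity_ball_le hn hld hrd hs x).trans_lt ENNReal.ofReal_lt_top)

theorem measure_forall_mem_daughter_void (hΦ : IsMaternClusterProcess parent X D lp ld rd P)
    (x : ℕ → EuclideanSpace ℝ (Fin n)) (a : ℝ≥0∞) (F : Finset ℕ) :
    P {ω | ∀ i ∈ F, a ≤ Metric.infEDist (x i) (D i ω).points}
      = ∏ i ∈ F, P {ω | a ≤ Metric.infEDist (x i) (D i ω).points} := by
  have := hΦ.iIndepFun_daughter.measure_inter_preimage_eq_mul F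
    (sets := fun i => {s | a ≤ Metric.infEDist (x i) s.points})
    (fun i _ => PointConfig.measurable_infEDist (x i) measurableSet_Ici)
  convert! this using 2
  ext ω
  simp

/-- The indices of the parent points in a ball form a finite set, whose cardinality is the number
of parent points there. -/
theorem exists_finset_parent (hΦ : IsMaternClusterProcess parent X D lp ld rd P)
    (y : EuclideanSpace ℝ (Fin n)) (ρ : ℝ) (ω : Ω) :
    ∃ F : Finset ℕ, (∀ i, i ∈ F ↔ ‖y - X i ω‖ < ρ) ∧
      F.card = ((parent ω).count (Metric.ball y ρ)).toNat := by
  have himg : (fun i => X i ω) '' {i | ‖y - X i ω‖ < ρ}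
      = (parent ω).points ∩ Metric.ball y ρ := by
    rw [← hΦ.range_X ω]
    ext z
    simp only [Set.mem_image, Set.mem_ofPred_eq, Set.mem_inter_iff, Set.mem_range,
      Metric.mem_ball', dist_eq_norm]
    constructor
    · rintro ⟨i, hi, rfl⟩
      exact ⟨⟨i, rfl⟩, hi⟩
    · rintro ⟨⟨i, rfl⟩, hi⟩
      exact ⟨i, hi, rfl⟩
  have hfin : {i | ‖y - X i ω‖ < ρ}.Finite := by
    -- Injectivity of the enumeration lets indices be counted as points.
    refine Set.Finite.of_finite_image ?_ (hΦ.injective_X ω).injOn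
    rw [himg]
    exact ((parent ω).locallyFinite _ (isCompact_closedBall y ρ)).subset
      (Set.inter_subset_inter_right _ Metric.ball_subset_closedBall)
  refine ⟨hfin.toFinset, by simp, ?_⟩
  rw [PointConfig.count, ← himg, (hΦ.injective_X ω).encard_image, ← Set.ncard_eq_toFinset_card _ hfin]
  rfl

theorem lintegral_pow_parent_count (hΦ : IsMaternClusterProcess parent X D lp ld rd P)
    (hn : 1 ≤ n) (hlp : 0 ≤ lp) {ρ q : ℝ} (hρ : 0 ≤ ρ) (hq : 0 ≤ q)
    (y : EuclideanSpace ℝ (Fin n)) :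
    ∫⁻ ω, ENNReal.ofReal q ^ ((parent ω).count (Metric.ball y ρ)).toNat ∂P
      = ENNReal.ofReal (Real.exp (-(unitBallVolume n * lp * ρ ^ n * (1 - q)))) := by
  have hB := parentIntensity_ball hn hlp y hρ
  rw [hΦ.isPoisson_parent.lintegral_pow_count measurableSet_ball
    (hB.trans_lt ENNReal.ofReal_lt_top) hq, measureReal_def, hB, ENNReal.toReal_ofReal]
  · congr 4; ring
  · have := unitBallVolume_nonneg n
    positivity

variable [IsProbabilityMeasure P]

/-- Clusters whose parents are at distance `|s - rd|` or more from `y` are ignored, which only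
enlarges the event. -/
theorem measure_le_contactDistance_le (hΦ : IsMaternClusterProcess parent X D lp ld rd P)
    (hn : 1 ≤ n) (hlp : 0 ≤ lp) (hld : 0 ≤ ld) (hrd : 0 ≤ rd) {s : ℝ} (hs : 0 ≤ s)
    (y : EuclideanSpace ℝ (Fin n)) :
    P {ω | ENNReal.ofReal s ≤ contactDistance (clusterProcess X D) y ω}
      ≤ ENNReal.ofReal (Real.exp (-(unitBallVolume n * lp * |s - rd| ^ n *
            (1 - Real.exp (-(ld * unitBallVolume n * min s rd ^ n)))))) := by
  rw [hΦ.measure_le_contactDistance, ← hΦ.lintegral_pow_parent_count hn hlp (abs_nonneg _)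
    (Real.exp_pos _).le y]
  refine lintegral_mono fun ω => ?_
  obtain ⟨F, hF, hcard⟩ := hΦ.exists_finset_parent y |s - rd| ω
  rw [← hcard, ← Finset.prod_const]
  calc _ ≤ P {ω' | ∀ i ∈ F, ENNReal.ofReal s ≤ Metric.infEDist (y - X i ω) (D i ω').points} :=
        measure_mono <| Set.ofPred_subset_ofPred.2 fun ω' h i _ => h i
    _ = _ := hΦ.measure_forall_mem_daughter_void (fun i => y - X i ω) _ F
    _ ≤ _ := Finset.prod_le_prod' fun i hi => by
      have := unitBallVolume_nonneg n
      rw [hΦ.measure_daughter_void hn hld hrd hs, measureReal_def,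
        daughterIntensity_ball_eq hn hld hrd hs ((hF i).1 hi),
        ENNReal.toReal_ofReal (by positivity), mul_assoc]

theorem le_measure_le_contactDistance (hΦ : IsMaternClusterProcess parent X D lp ld rd P)
    (hn : 1 ≤ n) (hlp : 0 ≤ lp) (hld : 0 ≤ ld) (hrd : 0 ≤ rd) {s : ℝ} (hs : 0 ≤ s)
    (y : EuclideanSpace ℝ (Fin n)) :
    ENNReal.ofReal (Real.exp (-(unitBallVolume n * lp * (s + rd) ^ n *
            (1 - Real.exp (-(ld * unitBallVolume n * min s rd ^ n))))))
      ≤ P {ω | ENNReal.ofReal s ≤ contactDistance (clusterProcess X D) y ω} := by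
  rw [hΦ.measure_le_contactDistance, ← hΦ.lintegral_pow_parent_count hn hlp (add_nonneg hs hrd)
    (Real.exp_pos _).le y]
  refine lintegral_mono fun ω => ?_
  obtain ⟨F, hF, hcard⟩ := hΦ.exists_finset_parent y (s + rd) ω
  rw [← hcard, ← Finset.prod_const]
  -- Far clusters miss the ball almost surely; being countably many, they do so simultaneously.
  have hfar : ∀ᵐ ω' ∂P, ∀ i, i ∉ F →
      ENNReal.ofReal s ≤ Metric.infEDist (y - X i ω) (D i ω').points := by
    rw [ae_all_iff]
    intro i
    by_cases hi : i ∈ F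
    · simp [hi]
    · have hmeas : MeasurableSet
          {ω' | ENNReal.ofReal s ≤ Metric.infEDist (y - X i ω) (D i ω').points} :=
        (PointConfig.measurable_infEDist (y - X i ω)).comp
          (hΦ.isPoisson_daughter i).measurable measurableSet_Ici
      have h1 := hΦ.measure_daughter_void hn hld hrd hs i (y - X i ω)
      rw [measureReal_def, daughterIntensity_ball_eq_zero (not_lt.1 fun h => hi ((hF i).2 h))] at h1
      simp only [hi, not_false_eq_true, forall_const]
      rw [ENNReal.toReal_zero, neg_zero, Real.exp_zero, ENNReal.ofReal_one] at h1
      exact (mem_ae_iff_prob_eq_one hmeas).2 h1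
  calc _ ≤ ∏ i ∈ F, P {ω' | ENNReal.ofReal s ≤ Metric.infEDist (y - X i ω) (D i ω').points} :=
        Finset.prod_le_prod' fun i hi => by
          have := unitBallVolume_nonneg n
          rw [hΦ.measure_daughter_void hn hld hrd hs]
          gcongr
          rw [mul_assoc]
          exact ENNReal.toReal_le_of_le_ofReal (by positivity)
            (daughterIntensity_ball_le hn hld hrd hs _)
    _ = _ := (hΦ.measure_forall_mem_daughter_void (fun i => y - X i ω) _ F).symm
    _ ≤ _ := measure_mono_ae <| by
      filter_upwards [hfar] with ω' hω' h i
      by_cases hi : i ∈ F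
      · exact h i hi
      · exact hω' i hi

theorem measureReal_contactDistance_lt (hΦ : IsMaternClusterProcess parent X D lp ld rd P)
    (y : EuclideanSpace ℝ (Fin n)) (a : ℝ≥0∞) :
    P.real {ω | contactDistance (clusterProcess X D) y ω < a}
      = 1 - P.real {ω | a ≤ contactDistance (clusterProcess X D) y ω} := by
  have hS : MeasurableSet {ω | a ≤ contactDistance (clusterProcess X D) y ω} :=
    hΦ.measurable_contactDistance y measurableSet_Ici
  rw [← probReal_compl_eq_one_sub hS]
  congr 1
  ext ω
  simp

end IsMaternClusterProcess

/-! ### From void probabilities to the distribution function -/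

theorem theorem3 {Ω : Type*} [MeasurableSpace Ω] (P : Measure Ω) [IsProbabilityMeasure P]
    (n : ℕ) (hn : 1 ≤ n) (lp ld rd : ℝ) (hlp : 0 < lp) (hld : 0 < ld) (hrd : 0 < rd)
    (parent : Ω → PointConfig (EuclideanSpace ℝ (Fin n)))
    (X : ℕ → Ω → EuclideanSpace ℝ (Fin n))
    (D : ℕ → Ω → PointConfig (EuclideanSpace ℝ (Fin n)))
    (hΦ : IsMaternClusterProcess parent X D lp ld rd P)
    (y : EuclideanSpace ℝ (Fin n)) :
    Measurable (contactDistance (clusterProcess X D) y) ∧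
    ∀ r : ℝ, 0 ≤ r →
      contactCDF P (clusterProcess X D) y r ≤
          1 - Real.exp (-(unitBallVolume n * lp *
            ((r + rd) ^ n * (1 - Real.exp (-(unitBallVolume n * ld * min r rd ^ n)))))) ∧
      1 - Real.exp (-(unitBallVolume n * lp * |r - rd| ^ n *
            (1 - Real.exp (-(ld * unitBallVolume n * min r rd ^ n))))) ≤
          contactCDF P (clusterProcess X D) y r := by
  refine ⟨hΦ.measurable_contactDistance y, fun r hr => ⟨?_, ?_⟩⟩
  -- The void bounds control `{R < s}`, not `{R ≤ r}`. Here `{R ≤ r} ⊆ {R < s}` for `s > r`, and `s`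
  -- decreases to `r` in a continuous bound; the other inequality needs only `{R < r} ⊆ {R ≤ r}`.
  · let g : ℝ → ℝ := fun s => 1 - Real.exp (-(unitBallVolume n * lp *
      ((s + rd) ^ n * (1 - Real.exp (-(unitBallVolume n * ld * min s rd ^ n))))))
    have hg : Continuous g := by fun_prop
    refine ge_of_tendsto (x := nhdsWithin r (Set.Ioi r)) (f := g)
      ((hg.tendsto r).mono_left nhdsWithin_le_nhds) ?_
    filter_upwards [self_mem_nhdsWithin] with s hs
    have hs' : r < s := hs
    have h0 : 0 < s := hr.trans_lt hs'
    have h1 := hΦ.le_measure_le_contactDistance hn hlp.le hld.le hrd.le h0.le y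
    rw [ENNReal.ofReal_le_iff_le_toReal (measure_ne_top _ _), ← measureReal_def] at h1
    have h2 : contactCDF P (clusterProcess X D) y r
        ≤ P.real {ω | contactDistance (clusterProcess X D) y ω < ENNReal.ofReal s} :=
      measureReal_mono <| Set.ofPred_subset_ofPred.2 fun ω hω => lt_of_le_of_lt hω ((ENNReal.ofReal_lt_ofReal_iff h0).2 hs')
    rw [hΦ.measureReal_contactDistance_lt] at h2
    refine h2.trans ((sub_le_sub_left h1 1).trans_eq ?_)
    simp only [g, mul_assoc, mul_left_comm ld]
  · have h1 := hΦ.measure_le_contactDistance_le hn hlp.le hld.le hrd.le hr y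
    have h1' := ENNReal.toReal_le_of_le_ofReal (Real.exp_pos _).le h1
    rw [← measureReal_def] at h1'
    refine (sub_le_sub_left h1' 1).trans ?_
    rw [← hΦ.measureReal_contactDistance_lt]
    exact measureReal_mono <| Set.ofPred_subset_ofPred.2 fun ω hω => le_of_lt hω
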